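/- Let $d\in\mathbb N$, let $\tilde P^{(1)}_1,\tilde P^{(1)}_2\in\mathbb R^{d\times d}$ and $\tilde P^{(2)}\in\mathbb R^{2d\times 2d}$ be symmetric positive semidefinite matrices, and let $H=\begin{bmatrix}I_d\\ I_d\end{bmatrix}\in\mathbb R^{2d\times d}$. Write $A\preceq B$ when $B-A$ is symmetric positive semidefinite. Consider the set of admissible covariances $$\mathcal A=\Big\{P^{(1)}+\tilde P^{(2)} \;:\; P^{(1)}\in\mathbb R^{2d\times 2d},\ P^{(1)}\succeq 0,\ P^{(1)}_{1,1}=\tilde P^{(1)}_1,\ P^{(1)}_{2,2}=\tilde P^{(1)}_2\Big\},$$ where $P^{(1)}_{i,i}$ are the diagonal $d\times d$ blocks. Let $J:\mathbb R^{d\times d}\to\mathbb R$ be increasing in the sense that $J(A)\le J(B)$ for all positive definite $A\preceq B$. The optimal conservative fusion problem for two estimators is $$\min_{K\in\mathbb R^{d\times 2d},\;B_F\in\mathbb R^{d\times d}} J(B_F)\quad\text{subject to}\quad KH=I_d,\qquad KPK^{\mathsf T}\preceq B_F\ \text{ for all } P\in\mathcal A .$$ Let $\mathcal K^2=\{\omega\in\mathbb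 R^2:\omega_1+\omega_2=1,\ \omega_i\ge 0\}$ and, for $\omega\in\mathcal K^2$ with $\omega_1,\omega_2>0$, let $$B_{\mathrm{cent}}^{\mathrm{ESCI}}(\omega)=\operatorname{diag}\!\Big(\tfrac1{\omega_1}\tilde P^{(1)}_1,\tfrac1{\omega_2}\tilde P^{(1)}_2\Big)+\tilde P^{(2)},$$ which is assumed to be positive definite (so that its inverse exists). Then $\omega\mapsto [B_{\mathrm{cent}}^{\mathrm{ESCI}}(\omega)]^{-1}$ extends continuously to all of $\mathcal K^2$; the extension is denoted by the same symbol. Moreover $H^{\mathsf T}[B_{\mathrm{cent}}^{\mathrm{ESCI}}(\omega)]^{-1}H$ is positive definite for every $\omega\in\mathcal K^2$, and one sets $$B_F^{\mathrm{ESCI}}(\omega)=\big(H^{\mathsf T}[B_{\mathrm{cent}}^{\mathrm{ESCI}}(\omega)]^{-1}H\big)^{-1}.$$ If $\omega^*\in\arg\min_{\omega\in\mathcal K^2}J\big(B_F^{\mathrm{ESCI}}(\omega)\big)$, then the pair $$K^*=B_F^{\mathrm{ESCI}}(\omega^*)\,H^{\mathsf T}\,[B_{\mathrm{cent}}^{\mathrm{ESCI}}(\omega^*)]^{-1},\qquad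 B_F^*=B_F^{\mathrm{ESCI}}(\omega^*)$$ is a solution of the optimal conservative fusion problem. -/

import Mathlib

open Matrix Topology

namespace ESCI

/-- Index type of centralized vectors for two estimators of a state in `ℝ^d`:
the first (resp. second) summand indexes the coordinates of the first (resp. second) estimator. -/
abbrev Cent (d : ℕ) : Type := Fin d ⊕ Fin d

/-- The Loewner order `A ⪯ B`: the difference `B - A` is (symmetric) positive semidefinite. -/
def LoewnerLE {n : Type*} [Fintype n] (A B : Matrix n n ℝ) : Prop := (B - A).PosSemidef

/-- The centralized observation matrix `H = 1₂ ⊗ I_d`, that is, `I_d` stacked on `I_d`. -/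
def obs (d : ℕ) : Matrix (Cent d) (Fin d) ℝ := Matrix.fromRows 1 1

/-- The set of admissible centralized covariances `P⁽¹⁾ + P₂`, where `P⁽¹⁾` runs over the positive
semidefinite matrices with prescribed diagonal blocks `P₁ 0`, `P₁ 1` (the covariances of the first
error components), and `P₂` is the known centralized covariance of the second components. -/
def admissible {d : ℕ} (P₁ : Fin 2 → Matrix (Fin d) (Fin d) ℝ)
    (P₂ : Matrix (Cent d) (Cent d) ℝ) : Set (Matrix (Cent d) (Cent d) ℝ) :=
  {P | ∃ X : Matrix (Cent d) (Cent d) ℝ, X.PosSemidef ∧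
    X.toBlocks₁₁ = P₁ 0 ∧ X.toBlocks₂₂ = P₁ 1 ∧ P = X + P₂}

/-- The pair `(K, B)` is feasible: the fusion is unbiased (`K H = I`) and `B` bounds the covariance
`K P Kᵀ` of the fused error for every admissible `P`. -/
def IsConservativeFusion {d : ℕ} (P₁ : Fin 2 → Matrix (Fin d) (Fin d) ℝ)
    (P₂ : Matrix (Cent d) (Cent d) ℝ)
    (K : Matrix (Fin d) (Cent d) ℝ) (B : Matrix (Fin d) (Fin d) ℝ) : Prop :=
  K * obs d = 1 ∧ ∀ P ∈ admissible P₁ P₂, LoewnerLE (K * P * Kᵀ) B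

/-- The pair `(K, B)` solves the optimal conservative fusion problem for the cost `J`: it is
feasible, and it minimizes `J` of the bound among all feasible pairs. -/
def IsOptimalFusion {d : ℕ} (P₁ : Fin 2 → Matrix (Fin d) (Fin d) ℝ)
    (P₂ : Matrix (Cent d) (Cent d) ℝ) (J : Matrix (Fin d) (Fin d) ℝ → ℝ)
    (K : Matrix (Fin d) (Cent d) ℝ) (B : Matrix (Fin d) (Fin d) ℝ) : Prop :=
  IsConservativeFusion P₁ P₂ K B ∧
    ∀ (K' : Matrix (Fin d) (Cent d) ℝ) (B' : Matrix (Fin d) (Fin d) ℝ),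
      IsConservativeFusion P₁ P₂ K' B' → J B ≤ J B'

/-- The (relative) interior of the unit simplex of `ℝ²`: both weights are positive. -/
def openSimplex : Set (Fin 2 → ℝ) := {ω ∈ stdSimplex ℝ (Fin 2) | ∀ i, 0 < ω i}

/-- The centralized bound `diag(P₁ 0 / ω₀, P₁ 1 / ω₁) + P₂`,
meaningful when both weights are positive. -/
noncomputable def centBound {d : ℕ} (P₁ : Fin 2 → Matrix (Fin d) (Fin d) ℝ)
    (P₂ : Matrix (Cent d) (Cent d) ℝ) (ω : Fin 2 → ℝ) : Matrix (Cent d) (Cent d) ℝ :=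
  Matrix.fromBlocks ((1 / ω 0) • P₁ 0) 0 0 ((1 / ω 1) • P₁ 1) + P₂

/-- The inverse of the centralized bound, extended by continuity from the interior of the simplex
to the whole simplex (the bound itself is infinite when a weight vanishes). -/
noncomputable def centBoundInv {d : ℕ} (P₁ : Fin 2 → Matrix (Fin d) (Fin d) ℝ)
    (P₂ : Matrix (Cent d) (Cent d) ℝ) : (Fin 2 → ℝ) → Matrix (Cent d) (Cent d) ℝ :=
  extendFrom openSimplex (fun ω => (centBound P₁ P₂ ω)⁻¹)

/-- The ESCI fused bound `B_F(ω) = (Hᵀ B_cent(ω)⁻¹ H)⁻¹`. -/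
noncomputable def fusedBound {d : ℕ} (P₁ : Fin 2 → Matrix (Fin d) (Fin d) ℝ)
    (P₂ : Matrix (Cent d) (Cent d) ℝ) (ω : Fin 2 → ℝ) : Matrix (Fin d) (Fin d) ℝ :=
  ((obs d)ᵀ * centBoundInv P₁ P₂ ω * obs d)⁻¹

/-- The ESCI gain `K(ω) = B_F(ω) Hᵀ B_cent(ω)⁻¹`. -/
noncomputable def gain {d : ℕ} (P₁ : Fin 2 → Matrix (Fin d) (Fin d) ℝ)
    (P₂ : Matrix (Cent d) (Cent d) ℝ) (ω : Fin 2 → ℝ) : Matrix (Fin d) (Cent d) ℝ :=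
  fusedBound P₁ P₂ ω * (obs d)ᵀ * centBoundInv P₁ P₂ ω

/-- The cost `J` is increasing (in the wide sense) for the Loewner order on the
positive definite matrices. -/
def IsIncreasingCost {d : ℕ} (J : Matrix (Fin d) (Fin d) ℝ → ℝ) : Prop :=
  ∀ A B : Matrix (Fin d) (Fin d) ℝ, A.PosDef → B.PosDef → LoewnerLE A B → J A ≤ J B

/-- At positive weights the extension by continuity is the genuine inverse. -/
theorem centBoundInv_eq {d : ℕ} (P₁ : Fin 2 → Matrix (Fin d) (Fin d) ℝ)
    (P₂ : Matrix (Cent d) (Cent d) ℝ) (ω : Fin 2 → ℝ) (hω : ω ∈ openSimplex)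
    (h : (centBound P₁ P₂ ω).PosDef) :
    centBoundInv P₁ P₂ ω = (centBound P₁ P₂ ω)⁻¹ := by
  have hdet : (centBound P₁ P₂ ω).det ≠ 0 := h.det_pos.ne'
  have h0 : ω 0 ≠ 0 := (hω.2 0).ne'
  have h1 : ω 1 ≠ 0 := (hω.2 1).ne'
  have hc : ContinuousAt (centBound P₁ P₂) ω := by
    unfold centBound
    refine ContinuousAt.add ?_ continuousAt_const
    refine tendsto_pi_nhds.2 fun i => tendsto_pi_nhds.2 fun j => ?_
    rcases i with i | i <;> rcases j with j | j <;>
      simp only [Matrix.fromBlocks_apply₁₁, Matrix.fromBlocks_apply₁₂,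
        Matrix.fromBlocks_apply₂₁, Matrix.fromBlocks_apply₂₂, Matrix.smul_apply, smul_eq_mul,
        Matrix.zero_apply]
    · exact ((continuousAt_const.div (continuous_apply 0).continuousAt h0).mul continuousAt_const)
    · exact tendsto_const_nhds
    · exact tendsto_const_nhds
    · exact ((continuousAt_const.div (continuous_apply 1).continuousAt h1).mul continuousAt_const)
  refine extendFrom_eq (subset_closure hω) (Filter.Tendsto.mono_left ?_ nhdsWithin_le_nhds)
  have hinv : ContinuousAt (fun A : Matrix (Cent d) (Cent d) ℝ => A⁻¹) (centBound P₁ P₂ ω) := by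
    refine continuousAt_matrix_inv _ ?_
    rw [Ring.inverse_eq_inv']
    exact continuousAt_inv₀ hdet
  exact ContinuousAt.comp (f := centBound P₁ P₂) hinv hc

end ESCI

/-!
Fix a conservative pair `(K, B)`. For a direction `x`, let `a₀(x)` and `a₁(x)` be the variances of
the two first error components in the direction `x` after fusion by `K`, and let
`c(x) = xᵀ (B - K P₂ Kᵀ) x`. Since the correlation of the two components is free, the worst case
over the admissible covariances is `(√a₀(x) + √a₁(x))²` (`exists_posSemidef_blocks_maximal`), so
conservativeness forces `(√a₀ + √a₁)² ≤ c` for every `x`. For each single `x` this gives weights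
`ω` with `a₀(x) / ω₀ + a₁(x) / ω₁ ≤ c(x)`; the heart of the proof is that one `ω` works for all `x`
(`exists_mem_stdSimplex_forall_le`, a form of Petersen's lemma). With `ω = (t, 1 - t)`, the good `t`
for a given `x` form a compact convex subset of `[0, 1]`, so by Helly's theorem on the line it is
enough to treat two directions `x`, `y`. If their sets were disjoint, some `t` between them would be
bad for both, with derivatives of opposite sign in `t`; a suitable `x + s • y` is then bad for `t`
and critical there, which violates `(√a₀ + √a₁)² ≤ c` in that direction.

The Gauss-Markov inequality `(Hᵀ M⁻¹ H)⁻¹ ⪯ K M Kᵀ` (`gaussMarkov`), applied to the centralized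
bound `M` at `ω`, turns this into `fusedBound ω ⪯ B` (`exists_fusedBound_le`), and monotonicity of the
cost finishes the comparison. Conversely the gain at any `ω` is conservative, since the centralized
bound dominates every admissible covariance (`centBound_sub_posSemidef`).

A weight may vanish. Near such a boundary point one block of the centralized bound blows up while
the rest converges; simultaneous diagonalization by congruence shows that the inverse has a limit
(`exists_tendsto_inv_smul_add`). Statements about the boundary are then obtained from the interior
by continuity, and the limit of `Hᵀ M⁻¹ H` stays positive definite by Cauchy-Schwarz against vectors
supported in a block whose weight does not vanish (`information_posDef`).
-/

namespace ESCI

/-! ### A common weight for three quadratic forms -/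

/-- The concave function `r ↦ r (1 - r) c - (1 - r) a - r b` is nonnegative at `s` and negative at a
later point `t`; then `c - a / r - b / (1 - r)` has negative derivative at `r = t`. The conclusion
is this sign, with denominators cleared. -/
theorem mul_sq_lt_of_pencil_neg {a b c s t : ℝ} (ha : 0 ≤ a) (hb : 0 ≤ b) (hc : 0 ≤ c)
    (hs : 0 ≤ s) (hst : s < t) (ht : t < 1)
    (h₁ : (1 - s) * a + s * b ≤ s * (1 - s) * c) (h₂ : t * (1 - t) * c < (1 - t) * a + t * b) :
    a * (1 - t) ^ 2 < b * t ^ 2 := by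
  have ht0 : 0 < t := hs.trans_lt hst
  have ht1 : 0 < 1 - t := sub_pos.2 ht
  by_contra! h
  rcases hs.eq_or_lt with rfl | hs0
  · have ha0 : a = 0 := le_antisymm (by linarith) ha
    have hb0 : b = 0 := by
      subst ha0
      have : 0 < t ^ 2 := by positivity
      nlinarith
    subst ha0 hb0
    have : 0 ≤ t * (1 - t) * c := by positivity
    linarith
  · have hs1 : 0 < 1 - s := by linarith
    have e₁ := mul_le_mul_of_nonneg_left h₁ (mul_pos ht0 ht1).le
    have e₂ := mul_lt_mul_of_pos_left h₂ (mul_pos hs0 hs1)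
    have e₃ : 0 < (t - s) * (b * s * t - a * (1 - s) * (1 - t)) := by linarith
    have e₄ := pos_of_mul_pos_right e₃ (sub_pos.2 hst).le
    have e₅ := mul_pos e₄ ht0
    have e₆ := mul_le_mul_of_nonneg_left h hs
    have e₇ : 0 ≤ a * (1 - t) * (t - s) := by
      have := sub_pos.2 hst
      positivity
    linarith

/-- A quadratic polynomial whose extreme coefficients have opposite signs has roots of both signs,
so one of them can be chosen with `s * m ≤ 0`. -/
theorem exists_root_mul_nonpos {p r : ℝ} (hp : p < 0) (hr : 0 < r) (q m : ℝ) :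
    ∃ s, p + 2 * s * q + s ^ 2 * r = 0 ∧ s * m ≤ 0 := by
  have hd : 0 ≤ q ^ 2 - p * r := by nlinarith [sq_nonneg q]
  have hlt : |q| < √(q ^ 2 - p * r) := by
    rw [← Real.sqrt_sq_eq_abs]
    exact Real.sqrt_lt_sqrt (sq_nonneg q) (by nlinarith)
  have hsq := Real.sq_sqrt hd
  set w := √(q ^ 2 - p * r)
  have hq := abs_lt.1 hlt
  rcases le_total 0 m with hm | hm
  · refine ⟨(-q - w) / r, by field_simp; linarith, mul_nonpos_of_nonpos_of_nonneg ?_ hm⟩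
    exact div_nonpos_of_nonpos_of_nonneg (by linarith) hr.le
  · refine ⟨(-q + w) / r, by field_simp; linarith, mul_nonpos_of_nonneg_of_nonpos ?_ hm⟩
    exact div_nonneg (by linarith) hr.le

section Forms

variable {V : Type*} [AddCommGroup V] [Module ℝ V] {α β γ : LinearMap.BilinForm ℝ V}

/-- If the weight `t` is bad for `x` and for `y`, with derivatives of `c - a / t - b / (1 - t)` of
opposite signs, some `z = x + s • y` is bad for `t` with zero derivative. Then
`√a : √b = t : (1 - t)` at `z`, so that `a / t + b / (1 - t) = (√a + √b) ^ 2`, contradicting `h`. -/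
theorem false_of_opposite_slopes (sα : α.IsSymm) (sβ : β.IsSymm) (sγ : γ.IsSymm)
    (hα : ∀ x, 0 ≤ α x x) (hβ : ∀ x, 0 ≤ β x x)
    (h : ∀ x, (√(α x x) + √(β x x)) ^ 2 ≤ γ x x) {t : ℝ} (ht0 : 0 < t) (ht1 : t < 1) {x y : V}
    (hx : t * (1 - t) * γ x x < (1 - t) * α x x + t * β x x)
    (hy : t * (1 - t) * γ y y < (1 - t) * α y y + t * β y y)
    (hx' : α x x * (1 - t) ^ 2 < β x x * t ^ 2) (hy' : β y y * t ^ 2 < α y y * (1 - t) ^ 2) :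
    False := by
  have hu : 0 < 1 - t := sub_pos.2 ht1
  -- `s` makes the derivative vanish at `z`; its sign keeps the mixed term from helping `z`.
  obtain ⟨s, hs, hsm⟩ := exists_root_mul_nonpos (sub_neg.2 hx') (sub_pos.2 hy')
    (α x y * (1 - t) ^ 2 - β x y * t ^ 2)
    (t * (1 - t) * γ x y - (1 - t) * α x y - t * β x y)
  have key (B : LinearMap.BilinForm ℝ V) (sB : B.IsSymm) :
      B (x + s • y) (x + s • y) = B x x + 2 * s * B x y + s ^ 2 * B y y := by
    have := sB.eq x y
    simp only [map_add, map_smul, LinearMap.add_apply, LinearMap.smul_apply, smul_eq_mul, ← this]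
    ring
  have kα := key α sα
  have kβ := key β sβ
  have kγ := key γ sγ
  have hz := h (x + s • y)
  have hαz := hα (x + s • y)
  have hβz := hβ (x + s • y)
  have hs2 : 0 ≤ s ^ 2 := sq_nonneg s
  have hneg : t * (1 - t) * γ (x + s • y) (x + s • y) <
      (1 - t) * α (x + s • y) (x + s • y) + t * β (x + s • y) (x + s • y) := by
    rw [kα, kβ, kγ]
    have := mul_le_mul_of_nonneg_left hy.le hs2
    linarith
  have hroot : α (x + s • y) (x + s • y) * (1 - t) ^ 2 = β (x + s • y) (x + s • y) * t ^ 2 := by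
    rw [kα, kβ]
    linarith
  generalize α (x + s • y) (x + s • y) = a at *
  generalize β (x + s • y) (x + s • y) = b at *
  generalize γ (x + s • y) (x + s • y) = c at *
  have e : √a * (1 - t) = √b * t := by
    rw [← sq_eq_sq₀ (by positivity) (by positivity), mul_pow, mul_pow, Real.sq_sqrt hαz,
      Real.sq_sqrt hβz, hroot]
  have ea := Real.sq_sqrt hαz
  have eb := Real.sq_sqrt hβz
  have e₁ : √a = t * (√a + √b) := by linarith
  have e₂ : √b = (1 - t) * (√a + √b) := by linarith
  have := mul_le_mul_of_nonneg_left hz (mul_pos ht0 hu).le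
  have h₁ : a = t ^ 2 * (√a + √b) ^ 2 := by rw [← mul_pow, ← e₁, ea]
  have h₂ : b = (1 - t) ^ 2 * (√a + √b) ^ 2 := by rw [← mul_pow, ← e₂, eb]
  have e₃ : (1 - t) * a + t * b = t * (1 - t) * (√a + √b) ^ 2 := by
    linear_combination (1 - t) * h₁ + t * h₂
  linarith

/-- The weights `t ∈ [0, 1]` with `α x x / t + β x x / (1 - t) ≤ γ x x`. Clearing denominators makes
the set closed and includes the endpoints, where it asks for `α x x ≤ 0`, resp. `β x x ≤ 0`. -/
def weightSet (α β γ : LinearMap.BilinForm ℝ V) (x : V) : Set ℝ :=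
  {t ∈ Set.Icc 0 1 | (1 - t) * α x x + t * β x x ≤ t * (1 - t) * γ x x}

theorem isCompact_weightSet (x : V) : IsCompact (weightSet α β γ x) :=
  isCompact_Icc.inter_right (isClosed_le
    (f := fun t : ℝ => (1 - t) * α x x + t * β x x) (g := fun t : ℝ => t * (1 - t) * γ x x)
    (by fun_prop) (by fun_prop))

theorem convex_weightSet {x : V} (hγ : 0 ≤ γ x x) : Convex ℝ (weightSet α β γ x) := by
  rintro s ⟨hs, hs'⟩ t ⟨ht, ht'⟩ p q hp hq hpq
  refine ⟨convex_Icc 0 1 hs ht hp hq hpq, ?_⟩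
  obtain rfl : q = 1 - p := by linarith
  have e₁ := mul_le_mul_of_nonneg_left hs' hp
  have e₂ := mul_le_mul_of_nonneg_left ht' hq
  have e₃ : 0 ≤ p * (1 - p) * (s - t) ^ 2 * γ x x := by positivity
  simp only [smul_eq_mul]
  linarith

theorem weightSet_nonempty (hα : ∀ x, 0 ≤ α x x) (hβ : ∀ x, 0 ≤ β x x)
    (h : ∀ x, (√(α x x) + √(β x x)) ^ 2 ≤ γ x x) (x : V) : (weightSet α β γ x).Nonempty := by
  have hx := h x
  have ea := Real.sq_sqrt (hα x)
  have eb := Real.sq_sqrt (hβ x)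
  have ha := Real.sqrt_nonneg (α x x)
  have hb := Real.sqrt_nonneg (β x x)
  rcases (add_nonneg ha hb).eq_or_lt with h0 | h0
  · have ha0 : √(α x x) = 0 := by linarith
    refine ⟨0, by simp, ?_⟩
    rw [ha0] at ea
    simp [← ea]
  · set m := √(α x x) + √(β x x) with hm
    have ht0 : 0 ≤ √(α x x) / m := by positivity
    have ht1 : √(α x x) / m ≤ 1 := by rw [div_le_one h0]; linarith
    refine ⟨√(α x x) / m, ⟨ht0, ht1⟩, ?_⟩
    have e₁ : √(α x x) = √(α x x) / m * m := by field_simp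
    have e₂ : √(β x x) = (1 - √(α x x) / m) * m := by field_simp; linarith
    generalize √(α x x) / m = t at *
    have := mul_le_mul_of_nonneg_left hx (mul_nonneg ht0 (sub_nonneg.2 ht1))
    rw [← ea, ← eb, e₁, e₂]
    linarith

theorem weightSet_inter_nonempty (sα : α.IsSymm) (sβ : β.IsSymm) (sγ : γ.IsSymm)
    (hα : ∀ x, 0 ≤ α x x) (hβ : ∀ x, 0 ≤ β x x)
    (h : ∀ x, (√(α x x) + √(β x x)) ^ 2 ≤ γ x x) (x y : V) :
    (weightSet α β γ x ∩ weightSet α β γ y).Nonempty := by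
  have hγ (x : V) : 0 ≤ γ x x := (sq_nonneg _).trans (h x)
  obtain ⟨u, hu⟩ := weightSet_nonempty hα hβ h x
  obtain ⟨v, hv⟩ := weightSet_nonempty hα hβ h y
  wlog huv : u ≤ v generalizing x y u v
  · rw [Set.inter_comm]
    exact this y x v hv u hu (le_of_not_ge huv)
  by_contra hempty
  -- Two disjoint closed sets cannot cover an interval that meets both.
  have hcov : ¬ Set.Icc u v ⊆ weightSet α β γ x ∪ weightSet α β γ y := fun hsub => by
    obtain ⟨t, -, ht⟩ := isPreconnected_closed_iff.1 isPreconnected_Icc _ _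
      (isCompact_weightSet x).isClosed (isCompact_weightSet y).isClosed hsub
      ⟨u, Set.left_mem_Icc.2 huv, hu⟩ ⟨v, Set.right_mem_Icc.2 huv, hv⟩
    exact hempty ⟨t, ht⟩
  obtain ⟨t, ⟨hut, htv⟩, ht⟩ := Set.not_subset.1 hcov
  rw [Set.mem_union, not_or] at ht
  obtain ⟨hxt, hyt⟩ := ht
  have hut' : u < t := lt_of_le_of_ne hut (by rintro rfl; exact hxt hu)
  have htv' : t < v := lt_of_le_of_ne htv (by rintro rfl; exact hyt hv)
  have ht0 : 0 < t := hu.1.1.trans_lt hut'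
  have ht1 : t < 1 := htv'.trans_le hv.1.2
  have hx : t * (1 - t) * γ x x < (1 - t) * α x x + t * β x x :=
    not_le.1 fun hle => hxt ⟨⟨ht0.le, ht1.le⟩, hle⟩
  have hy : t * (1 - t) * γ y y < (1 - t) * α y y + t * β y y :=
    not_le.1 fun hle => hyt ⟨⟨ht0.le, ht1.le⟩, hle⟩
  have hu2 := hu.2
  have hv2 := hv.2
  have hv1 := hv.1.2
  refine false_of_opposite_slopes sα sβ sγ hα hβ h ht0 ht1 hx hy
    (mul_sq_lt_of_pencil_neg (hα x) (hβ x) (hγ x) hu.1.1 hut' ht1 hu2 hx) ?_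
  -- The good point `v` of `y` lies after `t`; exchanging `t ↔ 1 - t` and `α ↔ β` puts it before.
  have := mul_sq_lt_of_pencil_neg (s := 1 - v) (t := 1 - t) (hβ y) (hα y) (hγ y)
    (by linarith) (by linarith) (by linarith) (by linarith) (by linarith)
  simpa using this

/-- By Helly's theorem in dimension one, nonempty pairwise intersections suffice. -/
theorem exists_forall_mem_weightSet (sα : α.IsSymm) (sβ : β.IsSymm) (sγ : γ.IsSymm)
    (hα : ∀ x, 0 ≤ α x x) (hβ : ∀ x, 0 ≤ β x x)
    (h : ∀ x, (√(α x x) + √(β x x)) ^ 2 ≤ γ x x) :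
    ∃ t, ∀ x, t ∈ weightSet α β γ x := by
  classical
  have hne : (⋂ x, weightSet α β γ x).Nonempty := by
    refine Convex.helly_theorem_compact' (𝕜 := ℝ)
      (fun x => convex_weightSet ((sq_nonneg _).trans (h x))) isCompact_weightSet fun I hI => ?_
    rw [Module.finrank_self] at hI
    obtain ⟨x, y, hxy⟩ : ∃ x y : V, I ⊆ {x, y} := by
      rcases hI.lt_or_eq with hlt | heq
      · obtain ⟨x, hx⟩ := Finset.card_le_one_iff_subset_singleton.1 (Nat.lt_succ_iff.1 hlt)
        exact ⟨x, x, by simpa using hx⟩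
      · obtain ⟨x, y, -, rfl⟩ := Finset.card_eq_two.1 heq
        exact ⟨x, y, subset_rfl⟩
    refine (weightSet_inter_nonempty sα sβ sγ hα hβ h x y).mono fun t ht => ?_
    simp only [Set.mem_iInter]
    intro z hz
    rcases Finset.mem_insert.1 (hxy hz) with rfl | hz
    · exact ht.1
    · rw [Finset.mem_singleton.1 hz]
      exact ht.2
  obtain ⟨t, ht⟩ := hne
  exact ⟨t, Set.mem_iInter.1 ht⟩

/-- **Petersen's lemma** for quadratic forms: if `(√α + √β) ^ 2 ≤ γ` pointwise, then a single weight
`ω` in the simplex gives `α / ω₀ + β / ω₁ ≤ γ`. When a weight vanishes, so does the form it divides,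
and the term `1 / 0 * 0` is the expected zero. -/
theorem exists_mem_stdSimplex_forall_le (sα : α.IsSymm) (sβ : β.IsSymm) (sγ : γ.IsSymm)
    (hα : ∀ x, 0 ≤ α x x) (hβ : ∀ x, 0 ≤ β x x)
    (h : ∀ x, (√(α x x) + √(β x x)) ^ 2 ≤ γ x x) :
    ∃ ω ∈ stdSimplex ℝ (Fin 2), ∀ x, (ω 0 = 0 → α x x = 0) ∧ (ω 1 = 0 → β x x = 0) ∧
      1 / ω 0 * α x x + 1 / ω 1 * β x x ≤ γ x x := by
  obtain ⟨t, ht⟩ := exists_forall_mem_weightSet sα sβ sγ hα hβ h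
  have ht01 : t ∈ Set.Icc (0 : ℝ) 1 := (ht 0).1
  refine ⟨![t, 1 - t], ⟨fun i => ?_, by simp⟩, fun x => ?_⟩
  · fin_cases i
    · exact ht01.1
    · exact sub_nonneg.2 ht01.2
  have hx := (ht x).2
  have hle := h x
  have ha := hα x
  have hb := hβ x
  simp only [cons_val_zero, cons_val_one]
  rcases ht01.1.eq_or_lt with rfl | h0
  · have ha0 : α x x = 0 := le_antisymm (by linarith) ha
    rw [ha0, Real.sqrt_zero, zero_add, Real.sq_sqrt hb] at hle
    exact ⟨fun _ => ha0, by simp, by simpa [ha0] using hle⟩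
  rcases ht01.2.eq_or_lt with rfl | h1
  · have hb0 : β x x = 0 := le_antisymm (by linarith) hb
    rw [hb0, Real.sqrt_zero, add_zero, Real.sq_sqrt ha] at hle
    exact ⟨by simp, fun _ => hb0, by simpa [hb0] using hle⟩
  have h1' : 0 < 1 - t := sub_pos.2 h1
  refine ⟨fun h => absurd h h0.ne', fun h => absurd h h1'.ne', ?_⟩
  have e : 1 / t * α x x + 1 / (1 - t) * β x x
      = ((1 - t) * α x x + t * β x x) / (t * (1 - t)) := by
    field_simp
  rw [e, div_le_iff₀ (mul_pos h0 h1')]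
  linarith

end Forms

/-! ### Real positive semidefinite matrices and limits of inverses -/

section Real

variable {n : Type*} [Fintype n]

theorem posSemidef_iff_real {M : Matrix n n ℝ} :
    M.PosSemidef ↔ Mᵀ = M ∧ ∀ x, 0 ≤ x ⬝ᵥ M *ᵥ x := by
  simp [posSemidef_iff_dotProduct_mulVec, IsHermitian, conjTranspose_eq_transpose_of_trivial]

theorem posDef_iff_real {M : Matrix n n ℝ} :
    M.PosDef ↔ Mᵀ = M ∧ ∀ x ≠ 0, 0 < x ⬝ᵥ M *ᵥ x := by
  simp [posDef_iff_dotProduct_mulVec, IsHermitian, conjTranspose_eq_transpose_of_trivial]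

theorem isSymm_toBilin' [DecidableEq n] {M : Matrix n n ℝ} (hM : Mᵀ = M) :
    (Matrix.toBilin' M).IsSymm := by
  refine ⟨fun x y => ?_⟩
  simp only [toBilin'_apply']
  rw [dotProduct_mulVec, ← mulVec_transpose, hM, dotProduct_comm]

/-- Cauchy-Schwarz for the form of a positive semidefinite matrix. -/
theorem sq_dotProduct_mulVec_le {M : Matrix n n ℝ} (hM : M.PosSemidef) (x y : n → ℝ) :
    (x ⬝ᵥ M *ᵥ y) ^ 2 ≤ (x ⬝ᵥ M *ᵥ x) * (y ⬝ᵥ M *ᵥ y) := by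
  classical
  rw [posSemidef_iff_real] at hM
  have := (Matrix.toBilin' M).apply_sq_le_of_symm (fun x => by simpa [toBilin'_apply'] using hM.2 x)
    ⟨(isSymm_toBilin' hM.1).eq⟩ x y
  simpa only [toBilin'_apply'] using this

theorem mul_mul_transpose_posSemidef {m : Type*} [Fintype m] {M : Matrix n n ℝ}
    (hM : M.PosSemidef) (K : Matrix m n ℝ) : (K * M * Kᵀ).PosSemidef := by
  simpa [conjTranspose_eq_transpose_of_trivial] using hM.mul_mul_conjTranspose_same K

theorem dotProduct_mul_mul_transpose_mulVec {m : Type*} [Fintype m] (K : Matrix m n ℝ)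
    (M : Matrix n n ℝ) (x : m → ℝ) :
    x ⬝ᵥ (K * M * Kᵀ) *ᵥ x = (Kᵀ *ᵥ x) ⬝ᵥ M *ᵥ (Kᵀ *ᵥ x) := by
  rw [← mulVec_mulVec, ← mulVec_mulVec, dotProduct_mulVec, ← mulVec_transpose]

variable [DecidableEq n]

theorem exists_orthogonal_diagonal {E : Matrix n n ℝ} (hE : E.PosSemidef) :
    ∃ (U : Matrix n n ℝ) (c : n → ℝ), 0 ≤ c ∧ Uᵀ * U = 1 ∧ Uᵀ * E * U = diagonal c := by
  have h₁ := hE.1.conjStarAlgAut_star_eigenvectorUnitary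
  have h₂ := Unitary.coe_star_mul_self hE.1.eigenvectorUnitary
  rw [Unitary.conjStarAlgAut_star_apply] at h₁
  rw [star_eq_conjTranspose, conjTranspose_eq_transpose_of_trivial] at h₁ h₂
  exact ⟨_, _, hE.eigenvalues_nonneg, h₂, h₁⟩

open scoped MatrixOrder in
/-- A positive definite and a positive semidefinite matrix are diagonalized by one congruence. -/
theorem exists_congr_diagonal {G E : Matrix n n ℝ} (hG : G.PosDef) (hE : E.PosSemidef) :
    ∃ (S : Matrix n n ℝ) (c : n → ℝ), 0 ≤ c ∧ Sᵀ * G * S = 1 ∧ Sᵀ * E * S = diagonal c := by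
  obtain ⟨L, hL⟩ := CStarAlgebra.nonneg_iff_eq_star_mul_self.mp hG.posSemidef.nonneg
  rw [star_eq_conjTranspose, conjTranspose_eq_transpose_of_trivial] at hL
  have hLu : IsUnit L.det := by
    have := hG.det_pos
    rw [hL, det_mul, det_transpose] at this
    exact isUnit_iff_ne_zero.2 fun h => by simp [h] at this
  have hE' : (L⁻¹ᵀ * E * L⁻¹).PosSemidef := by
    simpa using mul_mul_transpose_posSemidef hE L⁻¹ᵀ
  obtain ⟨U, c, hc, h₂, h₁⟩ := exists_orthogonal_diagonal hE'
  refine ⟨L⁻¹ * U, c, hc, ?_, ?_⟩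
  · have h₃ : L⁻¹ᵀ * Lᵀ = 1 := by rw [← transpose_mul, mul_nonsing_inv _ hLu, transpose_one]
    calc (L⁻¹ * U)ᵀ * G * (L⁻¹ * U)
        = Uᵀ * ((L⁻¹ᵀ * Lᵀ) * (L * L⁻¹)) * U := by
          rw [hL, transpose_mul]; simp only [Matrix.mul_assoc]
      _ = 1 := by rw [h₃, mul_nonsing_inv _ hLu, Matrix.mul_one, Matrix.mul_one, h₂]
  · rw [transpose_mul]
    simp only [Matrix.mul_assoc] at h₁ ⊢
    exact h₁

/-- The inverse of `u E + v F + Q` converges as `u → ∞` and `v → 1`, although the matrix itself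
diverges: in coordinates where `E + F + Q` is the identity and `E` is diagonal, the inverse is
diagonal up to a vanishing perturbation by `(v - 1) F`. -/
theorem exists_tendsto_inv_smul_add {ι : Type*} {l : Filter ι} {u v : ι → ℝ}
    {E F Q : Matrix n n ℝ} (hE : E.PosSemidef) (hG : (E + F + Q).PosDef)
    (hu : Filter.Tendsto u l Filter.atTop) (hv : Filter.Tendsto v l (𝓝 1)) :
    ∃ W, Filter.Tendsto (fun i => (u i • E + v i • F + Q)⁻¹) l (𝓝 W) := by
  obtain ⟨S, c, hc, hSG, hSE⟩ := exists_congr_diagonal hG hE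
  -- `Y r` is the inverse of `r E + G` with `G = E + F + Q`.
  set Y : ℝ → Matrix n n ℝ := fun r => S * diagonal (fun k => (1 + r * c k)⁻¹) * Sᵀ with hY
  have hYlim : Filter.Tendsto Y Filter.atTop
      (𝓝 (S * diagonal (fun k => if c k = 0 then 1 else 0) * Sᵀ)) := by
    have hd : Filter.Tendsto (fun r : ℝ => fun k => (1 + r * c k)⁻¹) Filter.atTop
        (𝓝 fun k => if c k = 0 then 1 else 0) := by
      refine tendsto_pi_nhds.2 fun k => ?_
      split_ifs with h
      · simp [h]
      · have hk : 0 < c k := lt_of_le_of_ne (hc k) (Ne.symm h)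
        exact tendsto_inv_atTop_zero.comp (Filter.tendsto_atTop_add_const_left _ _
          (Filter.tendsto_id.atTop_mul_const hk))
    have hcont : Continuous fun w : n → ℝ => S * diagonal w * Sᵀ :=
      (continuous_const.matrix_mul continuous_id.matrix_diagonal).matrix_mul continuous_const
    exact (hcont.tendsto _).comp hd
  have hYinv (r : ℝ) (hr : 0 ≤ r) : Y r * (r • E + (E + F + Q)) = 1 := by
    have hpos (k) : 1 + r * c k ≠ 0 := by
      have := mul_nonneg hr (hc k)
      positivity
    have hS : Sᵀ * (r • E + (E + F + Q)) * S = diagonal fun k => 1 + r * c k := by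
      rw [Matrix.mul_add, Matrix.add_mul, hSG, Matrix.mul_smul, Matrix.smul_mul, hSE, add_comm,
        ← diagonal_one, ← diagonal_smul, diagonal_add]
      rfl
    have hSi : S * (Sᵀ * (E + F + Q)) = 1 := mul_eq_one_comm.1 hSG
    have hSu : IsUnit S := (Matrix.isUnit_iff_isUnit_det _).2 (isUnit_det_of_right_inverse hSi)
    refine hSu.mul_right_cancel ?_
    calc Y r * (r • E + (E + F + Q)) * S
        = S * (diagonal (fun k => (1 + r * c k)⁻¹) * (Sᵀ * (r • E + (E + F + Q)) * S)) := by
          simp only [hY, Matrix.mul_assoc]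
      _ = 1 * S := by simp [hS, hpos]
  have hu' : Filter.Tendsto (fun i => u i - 1) l Filter.atTop :=
    Filter.tendsto_atTop_add_const_right _ _ hu
  have hYu := hYlim.comp hu'
  have hA : Filter.Tendsto (fun i => 1 + (v i - 1) • (Y (u i - 1) * F)) l (𝓝 1) := by
    have := ((hv.sub_const 1).smul (hYu.mul (tendsto_const_nhds (x := F)))).const_add
      (1 : Matrix n n ℝ)
    simpa using this
  have hAinv : Filter.Tendsto (fun i => (1 + (v i - 1) • (Y (u i - 1) * F))⁻¹) l (𝓝 1) := by
    have := (continuousAt_matrix_inv (1 : Matrix n n ℝ) (by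
      rw [Ring.inverse_eq_inv', det_one]
      exact continuousAt_inv₀ one_ne_zero)).tendsto.comp hA
    simpa [Function.comp_def] using this
  refine ⟨_, (hAinv.mul hYu).congr' ?_⟩
  filter_upwards [hu'.eventually_ge_atTop 0] with i hi
  have h₁ := hYinv _ hi
  have h₂ := mul_eq_one_comm.1 h₁
  simp only [Function.comp_apply]
  -- With `N = (u - 1) E + G`, the matrix `u E + v F + Q` is `N (1 + (v - 1) N⁻¹ F)`.
  rw [← inv_eq_left_inv h₁, ← Matrix.mul_inv_rev]
  congr 1
  rw [inv_eq_left_inv h₁, Matrix.mul_add, Matrix.mul_one, Matrix.mul_smul, ← Matrix.mul_assoc,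
    h₂, Matrix.one_mul]
  module

end Real

/-! ### The Gauss-Markov inequality -/

section GaussMarkov

variable {m n : Type*} [Fintype m] [Fintype n] [DecidableEq m] [DecidableEq n]

/-- The covariance of the optimal linear unbiased estimator of `x` from `H x` plus noise of
covariance `M`. -/
theorem gain_mul_mul_gain_transpose {M : Matrix n n ℝ} {H : Matrix n m ℝ} (hM : M.PosDef)
    (hS : (Hᵀ * M⁻¹ * H).PosDef) :
    ((Hᵀ * M⁻¹ * H)⁻¹ * Hᵀ * M⁻¹) * M * ((Hᵀ * M⁻¹ * H)⁻¹ * Hᵀ * M⁻¹)ᵀ = (Hᵀ * M⁻¹ * H)⁻¹ := by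
  have hMu : IsUnit M.det := hM.det_pos.ne'.isUnit
  have hSu : IsUnit (Hᵀ * M⁻¹ * H).det := hS.det_pos.ne'.isUnit
  have hMt : M⁻¹ᵀ = M⁻¹ := (posDef_iff_real.1 hM.inv).1
  have hSt : (Hᵀ * M⁻¹ * H)⁻¹ᵀ = (Hᵀ * M⁻¹ * H)⁻¹ := (posDef_iff_real.1 hS.inv).1
  rw [transpose_mul, transpose_mul, transpose_transpose, hMt, hSt,
    nonsing_inv_mul_cancel_right _ _ hMu]
  set S := Hᵀ * M⁻¹ * H
  calc S⁻¹ * Hᵀ * (M⁻¹ * (H * S⁻¹)) = S⁻¹ * S * S⁻¹ := by simp only [S, Matrix.mul_assoc]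
    _ = S⁻¹ := by rw [nonsing_inv_mul _ hSu, Matrix.one_mul]

/-- **Gauss-Markov**: among all `K` with `K H = 1`, the covariance `K M Kᵀ` is smallest, in the
Loewner order, for `K = (Hᵀ M⁻¹ H)⁻¹ Hᵀ M⁻¹`. -/
theorem gaussMarkov {M : Matrix n n ℝ} {H : Matrix n m ℝ} {K : Matrix m n ℝ} (hM : M.PosDef)
    (hS : (Hᵀ * M⁻¹ * H).PosDef) (hK : K * H = 1) :
    (K * M * Kᵀ - (Hᵀ * M⁻¹ * H)⁻¹).PosSemidef := by
  have hMu : IsUnit M.det := hM.det_pos.ne'.isUnit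
  have hMt : M⁻¹ᵀ = M⁻¹ := (posDef_iff_real.1 hM.inv).1
  have hSt : (Hᵀ * M⁻¹ * H)⁻¹ᵀ = (Hᵀ * M⁻¹ * H)⁻¹ := (posDef_iff_real.1 hS.inv).1
  have key := gain_mul_mul_gain_transpose hM hS
  set S := Hᵀ * M⁻¹ * H
  set L := S⁻¹ * Hᵀ * M⁻¹ with hL
  have hKt : Hᵀ * Kᵀ = 1 := by rw [← transpose_mul, hK, transpose_one]
  have h₁ : L * M * Kᵀ = S⁻¹ := by
    rw [hL, nonsing_inv_mul_cancel_right _ _ hMu, Matrix.mul_assoc, hKt, Matrix.mul_one]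
  have h₂ : K * M * Lᵀ = S⁻¹ := by
    have hLt : Lᵀ = M⁻¹ * (H * S⁻¹) := by
      rw [hL, transpose_mul, transpose_mul, hMt, hSt, transpose_transpose]
    rw [hLt, ← Matrix.mul_assoc, mul_nonsing_inv_cancel_right _ _ hMu, ← Matrix.mul_assoc, hK,
      Matrix.one_mul]
  have h₃ : K * M * Kᵀ - S⁻¹ = (K - L) * M * (K - L)ᵀ := by
    rw [transpose_sub, Matrix.sub_mul, Matrix.sub_mul, Matrix.mul_sub, Matrix.mul_sub, h₁, h₂, key]
    abel
  rw [h₃]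
  exact mul_mul_transpose_posSemidef hM.posSemidef _

end GaussMarkov

/-! ### Positive semidefinite matrices with prescribed diagonal blocks -/

section Blocks

variable {m n : Type*} [Fintype m] [Fintype n]

theorem dotProduct_fromBlocks_mulVec (A : Matrix m m ℝ) (C : Matrix m n ℝ) (B : Matrix n n ℝ)
    (p : m → ℝ) (q : n → ℝ) :
    Sum.elim p q ⬝ᵥ fromBlocks A C Cᵀ B *ᵥ Sum.elim p q =
      p ⬝ᵥ A *ᵥ p + q ⬝ᵥ B *ᵥ q + 2 * (p ⬝ᵥ C *ᵥ q) := by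
  have h : q ⬝ᵥ Cᵀ *ᵥ p = p ⬝ᵥ C *ᵥ q := by
    rw [mulVec_transpose, dotProduct_comm, dotProduct_mulVec]
  rw [fromBlocks_mulVec, sumElim_dotProduct_sumElim]
  simp only [Sum.elim_comp_inl, Sum.elim_comp_inr, dotProduct_add, h]
  ring

/-- With diagonal blocks `A` and `B` prescribed, the off-diagonal block can be chosen so that the
form at `(u, v)` reaches its largest possible value `(√(uᵀ A u) + √(vᵀ B v)) ^ 2`: take the rank-one
block `A u (B v)ᵀ / (√(uᵀ A u) √(vᵀ B v))`, or `0` when the denominator vanishes. -/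
theorem exists_posSemidef_blocks_maximal {A : Matrix m m ℝ} {B : Matrix n n ℝ} (hA : A.PosSemidef)
    (hB : B.PosSemidef) (u : m → ℝ) (v : n → ℝ) :
    ∃ X : Matrix (m ⊕ n) (m ⊕ n) ℝ, X.PosSemidef ∧ X.toBlocks₁₁ = A ∧ X.toBlocks₂₂ = B ∧
      Sum.elim u v ⬝ᵥ X *ᵥ Sum.elim u v = (√(u ⬝ᵥ A *ᵥ u) + √(v ⬝ᵥ B *ᵥ v)) ^ 2 := by
  have hA' := posSemidef_iff_real.1 hA
  have hB' := posSemidef_iff_real.1 hB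
  set a := u ⬝ᵥ A *ᵥ u with ha
  set b := v ⬝ᵥ B *ᵥ v with hb
  set k := (√a * √b)⁻¹ with hk
  have hk0 : 0 ≤ k := by positivity
  have hk1 : k * (√a * √b) ≤ 1 := inv_mul_le_one
  have hC (p : m → ℝ) (q : n → ℝ) : p ⬝ᵥ (k • vecMulVec (A *ᵥ u) (B *ᵥ v)) *ᵥ q =
      k * ((p ⬝ᵥ A *ᵥ u) * (q ⬝ᵥ B *ᵥ v)) := by
    rw [smul_mulVec, vecMulVec_mulVec, dotProduct_smul, dotProduct_comm (B *ᵥ v)]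
    simp [mul_comm]
  refine ⟨fromBlocks A (k • vecMulVec (A *ᵥ u) (B *ᵥ v)) (k • vecMulVec (A *ᵥ u) (B *ᵥ v))ᵀ B,
    posSemidef_iff_real.2 ⟨?_, fun x => ?_⟩, toBlocks_fromBlocks₁₁ .., toBlocks_fromBlocks₂₂ .., ?_⟩
  · rw [fromBlocks_transpose, transpose_transpose, hA'.1, hB'.1]
  · obtain ⟨p, q, rfl⟩ : ∃ p q, x = Sum.elim p q := ⟨_, _, (Sum.elim_comp_inl_inr x).symm⟩
    rw [dotProduct_fromBlocks_mulVec, hC]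
    have hp : |p ⬝ᵥ A *ᵥ u| ≤ √(p ⬝ᵥ A *ᵥ p) * √a := by
      rw [← Real.sqrt_mul (hA'.2 p)]
      exact Real.abs_le_sqrt (sq_dotProduct_mulVec_le hA p u)
    have hq : |q ⬝ᵥ B *ᵥ v| ≤ √(q ⬝ᵥ B *ᵥ q) * √b := by
      rw [← Real.sqrt_mul (hB'.2 q)]
      exact Real.abs_le_sqrt (sq_dotProduct_mulVec_le hB q v)
    have e₁ : |k * ((p ⬝ᵥ A *ᵥ u) * (q ⬝ᵥ B *ᵥ v))| ≤ √(p ⬝ᵥ A *ᵥ p) * √(q ⬝ᵥ B *ᵥ q) := by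
      rw [abs_mul, abs_mul, abs_of_nonneg hk0]
      calc k * (|p ⬝ᵥ A *ᵥ u| * |q ⬝ᵥ B *ᵥ v|)
          ≤ k * ((√(p ⬝ᵥ A *ᵥ p) * √a) * (√(q ⬝ᵥ B *ᵥ q) * √b)) := by gcongr
        _ = (k * (√a * √b)) * (√(p ⬝ᵥ A *ᵥ p) * √(q ⬝ᵥ B *ᵥ q)) := by ring
        _ ≤ 1 * (√(p ⬝ᵥ A *ᵥ p) * √(q ⬝ᵥ B *ᵥ q)) := by gcongr
        _ = _ := one_mul _
    have e₂ := neg_le_of_abs_le e₁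
    have e₃ := Real.sq_sqrt (hA'.2 p)
    have e₄ := Real.sq_sqrt (hB'.2 q)
    linarith [sq_nonneg (√(p ⬝ᵥ A *ᵥ p) - √(q ⬝ᵥ B *ᵥ q))]
  · rw [dotProduct_fromBlocks_mulVec, hC, ← ha, ← hb]
    have e₃ : √a ^ 2 = a := Real.sq_sqrt (hA'.2 u)
    have e₄ : √b ^ 2 = b := Real.sq_sqrt (hB'.2 v)
    have e₅ : k * (a * b) = √a * √b := by
      have hab : a * b = (√a * √b) ^ 2 := by rw [mul_pow, e₃, e₄]
      rw [hab, hk]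
      rcases eq_or_ne (√a * √b) 0 with h | h
      · simp [h]
      · rw [sq, inv_mul_cancel_left₀ h]
    rw [e₅]
    linear_combination -e₃ - e₄

/-- A positive semidefinite matrix is dominated by its diagonal blocks divided by weights of sum
one: the difference is the congruence of `X` by `diag(√(t / s), -√(s / t))`. -/
theorem weighted_blocks_sub_posSemidef [DecidableEq m] [DecidableEq n]
    {X : Matrix (m ⊕ n) (m ⊕ n) ℝ} (hX : X.PosSemidef)
    {s t : ℝ} (hs : 0 < s) (ht : 0 < t) (hst : s + t = 1) :
    (fromBlocks ((1 / s) • X.toBlocks₁₁) 0 0 ((1 / t) • X.toBlocks₂₂) - X).PosSemidef := by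
  set T : Matrix (m ⊕ n) (m ⊕ n) ℝ :=
    fromBlocks (√(t / s) • (1 : Matrix m m ℝ)) 0 0 (-√(s / t) • (1 : Matrix n n ℝ)) with hT
  have h₁ : √(t / s) * √(t / s) = 1 / s - 1 := by
    rw [Real.mul_self_sqrt (by positivity)]
    field_simp
    linarith
  have h₂ : √(s / t) * √(s / t) = 1 / t - 1 := by
    rw [Real.mul_self_sqrt (by positivity)]
    field_simp
    linarith
  have h₃ : √(t / s) * √(s / t) = 1 := by
    rw [← Real.sqrt_mul (by positivity), div_mul_div_comm, mul_comm, div_self (by positivity),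
      Real.sqrt_one]
  have h₄ : √(s / t) * √(t / s) = 1 := by rw [mul_comm, h₃]
  have key : fromBlocks ((1 / s) • X.toBlocks₁₁) 0 0 ((1 / t) • X.toBlocks₂₂) - X = T * X * Tᵀ := by
    conv_lhs => rw [← fromBlocks_toBlocks X]
    conv_rhs => rw [← fromBlocks_toBlocks X]
    rw [hT, fromBlocks_transpose, fromBlocks_multiply, fromBlocks_multiply, sub_eq_add_neg,
      fromBlocks_neg, fromBlocks_add]
    simp only [Matrix.smul_mul, Matrix.mul_smul, Matrix.one_mul, Matrix.mul_one, Matrix.zero_mul,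
      Matrix.mul_zero, transpose_smul, transpose_one, transpose_zero, smul_smul, add_zero, zero_add,
      neg_mul, mul_neg, neg_neg, h₁, h₂, h₃, h₄, toBlocks_fromBlocks₁₁, toBlocks_fromBlocks₂₂]
    congr 1 <;> module
  rw [key]
  exact mul_mul_transpose_posSemidef hX T

end Blocks

/-! ### The simplex of weights -/

section Simplex

theorem openSimplex_subset : openSimplex ⊆ stdSimplex ℝ (Fin 2) := fun _ h => h.1

theorem stdSimplex_subset_closure_openSimplex : stdSimplex ℝ (Fin 2) ⊆ closure openSimplex := by
  intro ω hω
  -- Approach `ω` along the segment to the barycentre.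
  have hlim : Filter.Tendsto (fun r : ℝ => (1 - r) • ω + r • (fun _ => 1 / 2 : Fin 2 → ℝ))
      (𝓝[Set.Ioo 0 1] 0) (𝓝 ω) := by
    have hc : Continuous fun r : ℝ => (1 - r) • ω + r • (fun _ => 1 / 2 : Fin 2 → ℝ) := by fun_prop
    have := (hc.tendsto 0).mono_left (nhdsWithin_le_nhds (s := Set.Ioo 0 1))
    simpa using this
  have : (𝓝[Set.Ioo (0 : ℝ) 1] 0).NeBot := left_nhdsWithin_Ioo_neBot one_pos
  refine mem_closure_of_tendsto hlim ?_
  filter_upwards [self_mem_nhdsWithin] with r hr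
  have hpos (i) : 0 < ((1 - r) • ω + r • (fun _ => 1 / 2 : Fin 2 → ℝ)) i := by
    have h₁ := mul_nonneg (sub_nonneg.2 hr.2.le) (hω.1 i)
    have h₂ := hr.1
    simp only [Pi.add_apply, Pi.smul_apply, smul_eq_mul]
    linarith
  refine ⟨⟨fun i => (hpos i).le, ?_⟩, hpos⟩
  have h := hω.2
  rw [Fin.sum_univ_two] at h ⊢
  simp only [Pi.add_apply, Pi.smul_apply, smul_eq_mul]
  linear_combination (1 - r) * h

theorem nhdsWithin_openSimplex_neBot {ω : Fin 2 → ℝ} (hω : ω ∈ stdSimplex ℝ (Fin 2)) :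
    (𝓝[openSimplex] ω).NeBot :=
  mem_closure_iff_nhdsWithin_neBot.1 (stdSimplex_subset_closure_openSimplex hω)

theorem nonneg_on_stdSimplex {f : (Fin 2 → ℝ) → ℝ} (hf : ContinuousOn f (stdSimplex ℝ (Fin 2)))
    (h : ∀ ω ∈ openSimplex, 0 ≤ f ω) {ω : Fin 2 → ℝ} (hω : ω ∈ stdSimplex ℝ (Fin 2)) :
    0 ≤ f ω := by
  have := nhdsWithin_openSimplex_neBot hω
  refine ge_of_tendsto ((hf ω hω).mono_left (nhdsWithin_mono _ openSimplex_subset)) ?_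
  filter_upwards [self_mem_nhdsWithin] with ω' hω' using h ω' hω'

end Simplex

/-! ### The centralized bound and its extended inverse -/

variable {d : ℕ} {P₁ : Fin 2 → Matrix (Fin d) (Fin d) ℝ} {P₂ : Matrix (Cent d) (Cent d) ℝ}

/-- The embedding `R_i` of `ℝ^d` as the `i`-th block of the centralized space, as a matrix; the
block diagonal part of the centralized bound is `∑ i, (1 / ω i) • R_i P₁ i R_iᵀ`. -/
def blockEmb (d : ℕ) : Fin 2 → Matrix (Cent d) (Fin d) ℝ := ![fromRows 1 0, fromRows 0 1]

theorem blockEmb_transpose_mul (i j : Fin 2) :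
    (blockEmb d i)ᵀ * blockEmb d j = if i = j then 1 else 0 := by
  fin_cases i <;> fin_cases j <;>
    simp [blockEmb, transpose_fromRows, fromCols_mul_fromRows]

theorem blockEmb_transpose_mul_obs (i : Fin 2) : (blockEmb d i)ᵀ * obs d = 1 := by
  fin_cases i <;> simp [blockEmb, obs, transpose_fromRows, fromCols_mul_fromRows]

theorem centBound_eq_sum (ω : Fin 2 → ℝ) : centBound P₁ P₂ ω =
    ∑ i, (1 / ω i) • (blockEmb d i * P₁ i * (blockEmb d i)ᵀ) + P₂ := by
  have h (A B : Matrix (Fin d) (Fin d) ℝ) : fromBlocks A 0 0 B =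
      fromBlocks A 0 0 0 + fromBlocks 0 0 0 B := by simp [fromBlocks_add]
  rw [centBound, Fin.sum_univ_two, h]
  ext (i | i) (j | j) <;>
    simp [blockEmb, transpose_fromRows, fromRows_mul, mul_fromCols]

theorem dotProduct_mul_centBound_mul_mulVec (K : Matrix (Fin d) (Cent d) ℝ) (ω : Fin 2 → ℝ)
    (x : Fin d → ℝ) : x ⬝ᵥ (K * centBound P₁ P₂ ω * Kᵀ) *ᵥ x =
      ∑ i, 1 / ω i * (x ⬝ᵥ ((K * blockEmb d i) * P₁ i * (K * blockEmb d i)ᵀ) *ᵥ x) +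
        x ⬝ᵥ (K * P₂ * Kᵀ) *ᵥ x := by
  rw [centBound_eq_sum, Matrix.mul_add, Matrix.add_mul, add_mulVec, dotProduct_add, Matrix.mul_sum,
    Matrix.sum_mul, sum_mulVec, dotProduct_sum]
  congr 1
  refine Finset.sum_congr rfl fun i _ => ?_
  rw [Matrix.mul_smul, Matrix.smul_mul, smul_mulVec, dotProduct_smul, smul_eq_mul, transpose_mul]
  simp only [Matrix.mul_assoc]

theorem blockEmb_transpose_mul_centBound_mul (j : Fin 2) (ω : Fin 2 → ℝ) :
    (blockEmb d j)ᵀ * centBound P₁ P₂ ω * blockEmb d j =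
      (1 / ω j) • P₁ j + (blockEmb d j)ᵀ * P₂ * blockEmb d j := by
  have h (i : Fin 2) : (blockEmb d j)ᵀ * (blockEmb d i * P₁ i * (blockEmb d i)ᵀ) * blockEmb d j =
      if i = j then P₁ i else 0 := by
    calc _ = ((blockEmb d j)ᵀ * blockEmb d i) * P₁ i * ((blockEmb d i)ᵀ * blockEmb d j) := by
          simp only [Matrix.mul_assoc]
      _ = _ := by
          rw [blockEmb_transpose_mul, blockEmb_transpose_mul]
          by_cases hij : i = j
          · subst hij; simp
          · simp [hij, Ne.symm hij]
  rw [centBound_eq_sum, Matrix.mul_add, Matrix.add_mul, Matrix.mul_sum, Matrix.sum_mul]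
  congr 1
  simp only [Matrix.mul_smul, Matrix.smul_mul, h, smul_ite, smul_zero, Finset.sum_ite_eq',
    Finset.mem_univ, if_true]

theorem tendsto_coord {ω : Fin 2 → ℝ} (i : Fin 2) :
    Filter.Tendsto (fun ω' : Fin 2 → ℝ => ω' i) (𝓝[openSimplex] ω) (𝓝 (ω i)) :=
  ((continuous_apply i).tendsto ω).mono_left nhdsWithin_le_nhds

theorem tendsto_one_div_coord {ω : Fin 2 → ℝ} {i : Fin 2} (hi : ω i ≠ 0) :
    Filter.Tendsto (fun ω' : Fin 2 → ℝ => 1 / ω' i) (𝓝[openSimplex] ω) (𝓝 (1 / ω i)) :=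
  tendsto_const_nhds.div (tendsto_coord i) hi

/-- The filter keeps the weight positive, so its inverse tends to `+∞` and not merely to infinity in
absolute value. -/
theorem tendsto_one_div_coord_atTop {ω : Fin 2 → ℝ} {i : Fin 2} (hi : ω i = 0) :
    Filter.Tendsto (fun ω' : Fin 2 → ℝ => 1 / ω' i) (𝓝[openSimplex] ω) Filter.atTop := by
  simp only [one_div]
  refine tendsto_inv_nhdsGT_zero.comp (tendsto_nhdsWithin_iff.2 ⟨hi ▸ tendsto_coord i, ?_⟩)
  filter_upwards [self_mem_nhdsWithin] with ω' hω' using hω'.2 i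

theorem half_mem_openSimplex : (fun _ => 1 / 2 : Fin 2 → ℝ) ∈ openSimplex :=
  ⟨⟨fun _ => by norm_num, by norm_num⟩, fun _ => by norm_num⟩

theorem blockEmb_mul_posSemidef (hP₁ : ∀ i, (P₁ i).PosSemidef) (i : Fin 2) :
    (blockEmb d i * P₁ i * (blockEmb d i)ᵀ).PosSemidef :=
  mul_mul_transpose_posSemidef (hP₁ i) _

/-- The coefficients `1 / ω i` equal to one belong to no point of the simplex, but twice this matrix
is the centralized bound at `(1/2, 1/2)` plus `P₂`. -/
theorem posDef_sum_blocks (hP₂ : P₂.PosSemidef)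
    (hB : ∀ ω ∈ openSimplex, (centBound P₁ P₂ ω).PosDef) :
    (∑ i, blockEmb d i * P₁ i * (blockEmb d i)ᵀ + P₂).PosDef := by
  have h := (hB _ half_mem_openSimplex).add_posSemidef hP₂
  rw [centBound_eq_sum, ← Finset.smul_sum] at h
  have h2 := h.smul (show (0 : ℝ) < 1 / 2 by norm_num)
  convert h2 using 1
  module

theorem exists_tendsto_centBound_inv (hP₁ : ∀ i, (P₁ i).PosSemidef) (hP₂ : P₂.PosSemidef)
    (hB : ∀ ω ∈ openSimplex, (centBound P₁ P₂ ω).PosDef)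
    {ω : Fin 2 → ℝ} (hω : ω ∈ stdSimplex ℝ (Fin 2)) :
    ∃ W, Filter.Tendsto (fun ω' => (centBound P₁ P₂ ω')⁻¹) (𝓝[openSimplex] ω) (𝓝 W) := by
  have hsum := hω.2
  have hE := blockEmb_mul_posSemidef (d := d) hP₁
  have hG := posDef_sum_blocks hP₂ hB
  rw [Fin.sum_univ_two] at hsum hG
  simp only [centBound_eq_sum, Fin.sum_univ_two]
  by_cases h0 : ω 0 = 0
  · have h1 : ω 1 = 1 := by linarith
    exact exists_tendsto_inv_smul_add (hE 0) hG (tendsto_one_div_coord_atTop h0)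
      (by simpa [h1] using tendsto_one_div_coord (ω := ω) (i := 1) (by simp [h1]))
  by_cases h1 : ω 1 = 0
  · have h0 : ω 0 = 1 := by linarith
    rw [add_comm (blockEmb d 0 * _ * _)] at hG
    obtain ⟨W, hW⟩ := exists_tendsto_inv_smul_add (hE 1) hG (tendsto_one_div_coord_atTop h1)
      (by simpa [h0] using tendsto_one_div_coord (ω := ω) (i := 0) (by simp [h0]))
    exact ⟨W, hW.congr fun ω' => by rw [add_comm ((1 / ω' 1) • _), one_div (ω' 0)]⟩
  have hmem : ω ∈ openSimplex := by
    refine ⟨hω, fun i => lt_of_le_of_ne (hω.1 i) ?_⟩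
    fin_cases i
    · exact Ne.symm h0
    · exact Ne.symm h1
  have hM := hB ω hmem
  rw [centBound_eq_sum, Fin.sum_univ_two] at hM
  refine ⟨_, (continuousAt_matrix_inv _ ?_).tendsto.comp
    ((((tendsto_one_div_coord h0).smul_const _).add
      ((tendsto_one_div_coord h1).smul_const _)).add_const P₂)⟩
  rw [Ring.inverse_eq_inv']
  exact continuousAt_inv₀ hM.det_pos.ne'

theorem tendsto_centBoundInv (hP₁ : ∀ i, (P₁ i).PosSemidef) (hP₂ : P₂.PosSemidef)
    (hB : ∀ ω ∈ openSimplex, (centBound P₁ P₂ ω).PosDef)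
    {ω : Fin 2 → ℝ} (hω : ω ∈ stdSimplex ℝ (Fin 2)) :
    Filter.Tendsto (fun ω' => (centBound P₁ P₂ ω')⁻¹) (𝓝[openSimplex] ω)
      (𝓝 (centBoundInv P₁ P₂ ω)) :=
  tendsto_extendFrom (exists_tendsto_centBound_inv hP₁ hP₂ hB hω)

theorem continuousOn_centBoundInv (hP₁ : ∀ i, (P₁ i).PosSemidef) (hP₂ : P₂.PosSemidef)
    (hB : ∀ ω ∈ openSimplex, (centBound P₁ P₂ ω).PosDef) :
    ContinuousOn (centBoundInv P₁ P₂) (stdSimplex ℝ (Fin 2)) := by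
  have : RegularSpace (Matrix (Cent d) (Cent d) ℝ) :=
    inferInstanceAs (RegularSpace (Cent d → Cent d → ℝ))
  exact continuousOn_extendFrom stdSimplex_subset_closure_openSimplex
    fun ω hω => exists_tendsto_centBound_inv hP₁ hP₂ hB hω

theorem continuous_dotProduct_mulVec {n : Type*} [Fintype n] (x : n → ℝ) :
    Continuous fun M : Matrix n n ℝ => x ⬝ᵥ M *ᵥ x :=
  continuous_const.dotProduct (continuous_id.matrix_mulVec continuous_const)

theorem posSemidef_on_stdSimplex {n : Type*} [Fintype n] {f : (Fin 2 → ℝ) → Matrix n n ℝ}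
    (hf : ContinuousOn f (stdSimplex ℝ (Fin 2))) (h : ∀ ω ∈ openSimplex, (f ω).PosSemidef)
    {ω : Fin 2 → ℝ} (hω : ω ∈ stdSimplex ℝ (Fin 2)) : (f ω).PosSemidef := by
  refine posSemidef_iff_real.2 ⟨?_, fun x => ?_⟩
  · have := nhdsWithin_openSimplex_neBot hω
    have hlim := (hf ω hω).mono_left (nhdsWithin_mono _ openSimplex_subset)
    have hlimT := (continuous_id.matrix_transpose.tendsto (f ω)).comp hlim
    refine tendsto_nhds_unique (hlimT.congr' ?_) hlim
    filter_upwards [self_mem_nhdsWithin] with ω' hω' using (posSemidef_iff_real.1 (h ω' hω')).1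
  · exact nonneg_on_stdSimplex ((continuous_dotProduct_mulVec x).comp_continuousOn hf)
      (fun ω' hω' => (posSemidef_iff_real.1 (h ω' hω')).2 x) hω

theorem centBoundInv_posSemidef (hP₁ : ∀ i, (P₁ i).PosSemidef) (hP₂ : P₂.PosSemidef)
    (hB : ∀ ω ∈ openSimplex, (centBound P₁ P₂ ω).PosDef)
    {ω : Fin 2 → ℝ} (hω : ω ∈ stdSimplex ℝ (Fin 2)) : (centBoundInv P₁ P₂ ω).PosSemidef := by
  refine posSemidef_on_stdSimplex (continuousOn_centBoundInv hP₁ hP₂ hB) (fun ω' hω' => ?_) hω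
  rw [centBoundInv_eq P₁ P₂ ω' hω' (hB ω' hω')]
  exact (hB ω' hω').inv.posSemidef

/-- For `z = R_j x` and `M` the centralized bound, Cauchy-Schwarz for `M` gives
`(xᵀ x)² ≤ (zᵀ M z) (xᵀ Hᵀ M⁻¹ H x)`. If the weight `ω j` is nonzero, the first factor stays bounded
up to `ω`, so the second one cannot vanish in the limit unless `x = 0`. -/
theorem information_posDef (hP₁ : ∀ i, (P₁ i).PosSemidef) (hP₂ : P₂.PosSemidef)
    (hB : ∀ ω ∈ openSimplex, (centBound P₁ P₂ ω).PosDef)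
    {ω : Fin 2 → ℝ} (hω : ω ∈ stdSimplex ℝ (Fin 2)) :
    ((obs d)ᵀ * centBoundInv P₁ P₂ ω * obs d).PosDef := by
  have hW := mul_mul_transpose_posSemidef (centBoundInv_posSemidef hP₁ hP₂ hB hω) (obs d)ᵀ
  rw [transpose_transpose] at hW
  rw [posSemidef_iff_real] at hW
  refine posDef_iff_real.2 ⟨hW.1, fun x hx => lt_of_le_of_ne (hW.2 x) fun h0 => hx ?_⟩
  obtain ⟨j, hj⟩ : ∃ j, ω j ≠ 0 := by
    by_contra! h
    have := hω.2
    simp [h] at this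
  have := nhdsWithin_openSimplex_neBot hω
  have key : (x ⬝ᵥ x) ^ 2 ≤
      (x ⬝ᵥ ((1 / ω j) • P₁ j + (blockEmb d j)ᵀ * P₂ * blockEmb d j) *ᵥ x) *
        (x ⬝ᵥ ((obs d)ᵀ * centBoundInv P₁ P₂ ω * obs d) *ᵥ x) := by
    have hc : Continuous fun W : Matrix (Cent d) (Cent d) ℝ => (obs d)ᵀ * W * obs d :=
      (continuous_const.matrix_mul continuous_id).matrix_mul continuous_const
    have h₁ := ((continuous_dotProduct_mulVec x).tendsto _).comp
      (((tendsto_one_div_coord hj).smul_const (P₁ j)).add_const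
        ((blockEmb d j)ᵀ * P₂ * blockEmb d j))
    have h₂ := (((continuous_dotProduct_mulVec x).comp hc).tendsto _).comp
      (tendsto_centBoundInv hP₁ hP₂ hB hω)
    refine ge_of_tendsto (h₁.mul h₂) ?_
    filter_upwards [self_mem_nhdsWithin] with ω' hω'
    have hM := hB ω' hω'
    set M := centBound P₁ P₂ ω'
    have hMu : IsUnit M.det := hM.det_pos.ne'.isUnit
    have hMM : M *ᵥ (M⁻¹ *ᵥ (obs d *ᵥ x)) = obs d *ᵥ x := by
      rw [mulVec_mulVec, mul_nonsing_inv _ hMu, one_mulVec]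
    have hcs := sq_dotProduct_mulVec_le hM.posSemidef (blockEmb d j *ᵥ x)
      (M⁻¹ *ᵥ (obs d *ᵥ x))
    have e₁ : (blockEmb d j *ᵥ x) ⬝ᵥ M *ᵥ (M⁻¹ *ᵥ (obs d *ᵥ x)) = x ⬝ᵥ x := by
      rw [hMM, ← vecMul_transpose,
        ← dotProduct_mulVec, mulVec_mulVec, blockEmb_transpose_mul_obs, one_mulVec]
    have e₂ : (blockEmb d j *ᵥ x) ⬝ᵥ M *ᵥ (blockEmb d j *ᵥ x) =
        x ⬝ᵥ ((1 / ω' j) • P₁ j + (blockEmb d j)ᵀ * P₂ * blockEmb d j) *ᵥ x := by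
      rw [← blockEmb_transpose_mul_centBound_mul]
      have := dotProduct_mul_mul_transpose_mulVec (blockEmb d j)ᵀ M x
      rw [transpose_transpose] at this
      exact this.symm
    have e₃ : (M⁻¹ *ᵥ (obs d *ᵥ x)) ⬝ᵥ M *ᵥ (M⁻¹ *ᵥ (obs d *ᵥ x)) =
        x ⬝ᵥ ((obs d)ᵀ * M⁻¹ * obs d) *ᵥ x := by
      have := dotProduct_mul_mul_transpose_mulVec (obs d)ᵀ M⁻¹ x
      rw [transpose_transpose] at this
      rw [hMM, this, dotProduct_comm]
    rw [e₁, e₂, e₃] at hcs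
    exact hcs
  rw [← h0, mul_zero] at key
  exact dotProduct_self_eq_zero.1 (pow_eq_zero_iff two_ne_zero |>.1 (le_antisymm key (sq_nonneg _)))

/-! ### Optimality of the fused bound -/

theorem fusedBound_posDef (hP₁ : ∀ i, (P₁ i).PosSemidef) (hP₂ : P₂.PosSemidef)
    (hB : ∀ ω ∈ openSimplex, (centBound P₁ P₂ ω).PosDef)
    {ω : Fin 2 → ℝ} (hω : ω ∈ stdSimplex ℝ (Fin 2)) : (fusedBound P₁ P₂ ω).PosDef :=
  (information_posDef hP₁ hP₂ hB hω).inv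

theorem continuousOn_fusedBound (hP₁ : ∀ i, (P₁ i).PosSemidef) (hP₂ : P₂.PosSemidef)
    (hB : ∀ ω ∈ openSimplex, (centBound P₁ P₂ ω).PosDef) :
    ContinuousOn (fusedBound P₁ P₂) (stdSimplex ℝ (Fin 2)) := by
  intro ω hω
  have hc : Continuous fun W : Matrix (Cent d) (Cent d) ℝ => (obs d)ᵀ * W * obs d :=
    (continuous_const.matrix_mul continuous_id).matrix_mul continuous_const
  refine (continuousAt_matrix_inv _ ?_).comp_continuousWithinAt
    ((hc.comp_continuousOn (continuousOn_centBoundInv hP₁ hP₂ hB)) ω hω)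
  rw [Ring.inverse_eq_inv']
  exact continuousAt_inv₀ (information_posDef hP₁ hP₂ hB hω).det_pos.ne'

theorem continuousOn_gain (hP₁ : ∀ i, (P₁ i).PosSemidef) (hP₂ : P₂.PosSemidef)
    (hB : ∀ ω ∈ openSimplex, (centBound P₁ P₂ ω).PosDef) :
    ContinuousOn (gain P₁ P₂) (stdSimplex ℝ (Fin 2)) := by
  have hc : Continuous fun p : Matrix (Fin d) (Fin d) ℝ × Matrix (Cent d) (Cent d) ℝ =>
      p.1 * (obs d)ᵀ * p.2 :=
    (continuous_fst.matrix_mul continuous_const).matrix_mul continuous_snd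
  have h := hc.comp_continuousOn
    ((continuousOn_fusedBound hP₁ hP₂ hB).prodMk (continuousOn_centBoundInv hP₁ hP₂ hB))
  refine h.congr fun ω _ => ?_
  rw [gain, Function.comp_apply]

theorem centBound_sub_posSemidef {P : Matrix (Cent d) (Cent d) ℝ} (hP : P ∈ admissible P₁ P₂)
    {ω : Fin 2 → ℝ} (hω : ω ∈ openSimplex) : (centBound P₁ P₂ ω - P).PosSemidef := by
  obtain ⟨X, hX, h0, h1, rfl⟩ := hP
  have hsum := hω.1.2
  rw [Fin.sum_univ_two] at hsum
  have := weighted_blocks_sub_posSemidef hX (hω.2 0) (hω.2 1) hsum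
  rw [h0, h1] at this
  rwa [centBound, add_sub_add_right_eq_sub]

theorem isConservativeFusion_gain (hP₁ : ∀ i, (P₁ i).PosSemidef) (hP₂ : P₂.PosSemidef)
    (hB : ∀ ω ∈ openSimplex, (centBound P₁ P₂ ω).PosDef)
    {ω : Fin 2 → ℝ} (hω : ω ∈ stdSimplex ℝ (Fin 2)) :
    IsConservativeFusion P₁ P₂ (gain P₁ P₂ ω) (fusedBound P₁ P₂ ω) := by
  refine ⟨?_, fun P hP => ?_⟩
  · rw [gain, fusedBound, Matrix.mul_assoc, Matrix.mul_assoc, ← Matrix.mul_assoc (obs d)ᵀ]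
    exact nonsing_inv_mul _ (information_posDef hP₁ hP₂ hB hω).det_pos.ne'.isUnit
  · have hc : Continuous fun p : Matrix (Fin d) (Fin d) ℝ × Matrix (Fin d) (Cent d) ℝ =>
        p.1 - p.2 * P * p.2ᵀ :=
      continuous_fst.sub ((continuous_snd.matrix_mul continuous_const).matrix_mul
        continuous_snd.matrix_transpose)
    refine posSemidef_on_stdSimplex (hc.comp_continuousOn
      ((continuousOn_fusedBound hP₁ hP₂ hB).prodMk (continuousOn_gain hP₁ hP₂ hB)))
      (fun ω' hω' => ?_) hω
    have hM := hB ω' hω'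
    have hS := information_posDef hP₁ hP₂ hB hω'.1
    have h := mul_mul_transpose_posSemidef (centBound_sub_posSemidef hP hω') (gain P₁ P₂ ω')
    rw [centBoundInv_eq P₁ P₂ ω' hω' hM] at hS
    have key : gain P₁ P₂ ω' * centBound P₁ P₂ ω' * (gain P₁ P₂ ω')ᵀ = fusedBound P₁ P₂ ω' := by
      rw [gain, fusedBound, centBoundInv_eq P₁ P₂ ω' hω' hM]
      exact gain_mul_mul_gain_transpose hM hS
    rwa [Matrix.mul_sub, Matrix.sub_mul, key] at h

/-- The Gauss-Markov inequality in the direction `x`, up to the boundary. Where a weight vanishes,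
`centBound` has the junk coefficient `1 / 0 = 0`; by `hx` the corresponding term is zero in the
direction `x` for all weights, so this is also its limit. -/
theorem dotProduct_fusedBound_mulVec_le (hP₁ : ∀ i, (P₁ i).PosSemidef) (hP₂ : P₂.PosSemidef)
    (hB : ∀ ω ∈ openSimplex, (centBound P₁ P₂ ω).PosDef)
    {K : Matrix (Fin d) (Cent d) ℝ} (hK : K * obs d = 1)
    {ω : Fin 2 → ℝ} (hω : ω ∈ stdSimplex ℝ (Fin 2)) (x : Fin d → ℝ)
    (hx : ∀ i, ω i = 0 → x ⬝ᵥ ((K * blockEmb d i) * P₁ i * (K * blockEmb d i)ᵀ) *ᵥ x = 0) :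
    x ⬝ᵥ fusedBound P₁ P₂ ω *ᵥ x ≤ x ⬝ᵥ (K * centBound P₁ P₂ ω * Kᵀ) *ᵥ x := by
  have := nhdsWithin_openSimplex_neBot hω
  have h₁ : Filter.Tendsto (fun ω' => x ⬝ᵥ fusedBound P₁ P₂ ω' *ᵥ x) (𝓝[openSimplex] ω)
      (𝓝 (x ⬝ᵥ fusedBound P₁ P₂ ω *ᵥ x)) :=
    (((continuous_dotProduct_mulVec x).comp_continuousOn
      (continuousOn_fusedBound hP₁ hP₂ hB)) ω hω).mono_left (nhdsWithin_mono _ openSimplex_subset)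
  have h₂ : Filter.Tendsto (fun ω' => x ⬝ᵥ (K * centBound P₁ P₂ ω' * Kᵀ) *ᵥ x) (𝓝[openSimplex] ω)
      (𝓝 (x ⬝ᵥ (K * centBound P₁ P₂ ω * Kᵀ) *ᵥ x)) := by
    simp only [dotProduct_mul_centBound_mul_mulVec]
    refine (tendsto_finsetSum _ fun i _ => ?_).add_const _
    by_cases hi : ω i = 0
    · simp only [hx i hi, mul_zero, tendsto_const_nhds]
    · exact (tendsto_one_div_coord hi).mul_const _
  refine le_of_tendsto_of_tendsto h₁ h₂ ?_
  filter_upwards [self_mem_nhdsWithin] with ω' hω'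
  have hM := hB ω' hω'
  have hS := information_posDef hP₁ hP₂ hB hω'.1
  rw [centBoundInv_eq P₁ P₂ ω' hω' hM] at hS
  have h := (posSemidef_iff_real.1 (gaussMarkov hM hS hK)).2 x
  rw [sub_mulVec, dotProduct_sub, sub_nonneg] at h
  rwa [fusedBound, centBoundInv_eq P₁ P₂ ω' hω' hM]

/-- Every conservative bound dominates a fused bound of the family. -/
theorem exists_fusedBound_le (hP₁ : ∀ i, (P₁ i).PosSemidef) (hP₂ : P₂.PosSemidef)
    (hB : ∀ ω ∈ openSimplex, (centBound P₁ P₂ ω).PosDef)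
    {K : Matrix (Fin d) (Cent d) ℝ} {B : Matrix (Fin d) (Fin d) ℝ}
    (h : IsConservativeFusion P₁ P₂ K B) :
    ∃ ω ∈ stdSimplex ℝ (Fin 2), LoewnerLE (fusedBound P₁ P₂ ω) B := by
  set A : Fin 2 → Matrix (Fin d) (Fin d) ℝ :=
    fun i => (K * blockEmb d i) * P₁ i * (K * blockEmb d i)ᵀ with hA
  have hApsd (i) : (A i).PosSemidef := mul_mul_transpose_posSemidef (hP₁ i) _
  have hA' (i) := posSemidef_iff_real.1 (hApsd i)
  have hQ := posSemidef_iff_real.1 (mul_mul_transpose_posSemidef hP₂ K)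
  -- Conservativeness against the admissible covariance that is worst in the direction `x`; the
  -- symmetry of `B` is a by-product, as an admissible covariance is needed for it.
  have hbound (x : Fin d → ℝ) : Bᵀ = B ∧ (√(x ⬝ᵥ A 0 *ᵥ x) + √(x ⬝ᵥ A 1 *ᵥ x)) ^ 2 ≤
      x ⬝ᵥ (B - K * P₂ * Kᵀ) *ᵥ x := by
    obtain ⟨X, hX, h0, h1, hmax⟩ := exists_posSemidef_blocks_maximal (hP₁ 0) (hP₁ 1)
      ((K * blockEmb d 0)ᵀ *ᵥ x) ((K * blockEmb d 1)ᵀ *ᵥ x)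
    have hsplit : Sum.elim ((K * blockEmb d 0)ᵀ *ᵥ x) ((K * blockEmb d 1)ᵀ *ᵥ x) = Kᵀ *ᵥ x := by
      rw [transpose_mul, transpose_mul, ← mulVec_mulVec, ← mulVec_mulVec]
      generalize Kᵀ *ᵥ x = y
      ext (i | i) <;> simp [blockEmb, transpose_fromRows, fromCols_mulVec]
    have hle := posSemidef_iff_real.1 (h.2 _ ⟨X, hX, h0, h1, rfl⟩)
    have hKX := posSemidef_iff_real.1 (mul_mul_transpose_posSemidef hX K)
    rw [Matrix.mul_add, Matrix.add_mul] at hle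
    constructor
    · have := hle.1
      rw [transpose_sub, transpose_add, hKX.1, hQ.1] at this
      simpa using this
    · have hx := hle.2 x
      rw [hsplit, ← dotProduct_mul_mul_transpose_mulVec, ← dotProduct_mul_mul_transpose_mulVec,
        ← dotProduct_mul_mul_transpose_mulVec] at hmax
      rw [← hmax]
      simp only [sub_mulVec, add_mulVec, dotProduct_sub, dotProduct_add] at hx ⊢
      linarith
  have hBsymm := (hbound 0).1
  obtain ⟨ω, hω, hωx⟩ := exists_mem_stdSimplex_forall_le (isSymm_toBilin' (hA' 0).1)
    (isSymm_toBilin' (hA' 1).1)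
    (isSymm_toBilin' (M := B - K * P₂ * Kᵀ) (by rw [transpose_sub, hBsymm, hQ.1]))
    (fun x => by simpa only [toBilin'_apply'] using (hA' 0).2 x)
    (fun x => by simpa only [toBilin'_apply'] using (hA' 1).2 x)
    (fun x => by simpa only [toBilin'_apply'] using (hbound x).2)
  simp only [toBilin'_apply'] at hωx
  refine ⟨ω, hω, posSemidef_iff_real.2 ⟨?_, fun x => ?_⟩⟩
  · rw [transpose_sub, hBsymm, (posDef_iff_real.1 (fusedBound_posDef hP₁ hP₂ hB hω)).1]
  obtain ⟨h0, h1, hle⟩ := hωx x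
  have hfb := dotProduct_fusedBound_mulVec_le hP₁ hP₂ hB h.1 hω x fun i => by
    fin_cases i
    · exact h0
    · exact h1
  rw [dotProduct_mul_centBound_mul_mulVec, Fin.sum_univ_two] at hfb
  simp only [sub_mulVec, dotProduct_sub] at hle ⊢
  linarith

end ESCI

theorem mainTheorem2 (d : ℕ) (P₁ : Fin 2 → Matrix (Fin d) (Fin d) ℝ)
    (P₂ : Matrix (ESCI.Cent d) (ESCI.Cent d) ℝ)
    (hP₁ : ∀ i, (P₁ i).PosSemidef) (hP₂ : P₂.PosSemidef)
    (hB : ∀ ω ∈ ESCI.openSimplex, (ESCI.centBound P₁ P₂ ω).PosDef)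
    (J : Matrix (Fin d) (Fin d) ℝ → ℝ) (hJ : ESCI.IsIncreasingCost J) :
    ContinuousOn (ESCI.centBoundInv P₁ P₂) (stdSimplex ℝ (Fin 2)) ∧
    (∀ ω ∈ stdSimplex ℝ (Fin 2),
      ((ESCI.obs d)ᵀ * ESCI.centBoundInv P₁ P₂ ω * ESCI.obs d).PosDef) ∧
    ∀ ω ∈ stdSimplex ℝ (Fin 2),
      IsMinOn (fun ω' => J (ESCI.fusedBound P₁ P₂ ω')) (stdSimplex ℝ (Fin 2)) ω →
      ESCI.IsOptimalFusion P₁ P₂ J (ESCI.gain P₁ P₂ ω) (ESCI.fusedBound P₁ P₂ ω) := by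
  refine ⟨ESCI.continuousOn_centBoundInv hP₁ hP₂ hB,
    fun ω hω => ESCI.information_posDef hP₁ hP₂ hB hω, fun ω hω hmin =>
    ⟨ESCI.isConservativeFusion_gain hP₁ hP₂ hB hω, fun K B hKB => ?_⟩⟩
  obtain ⟨ω', hω', hle⟩ := ESCI.exists_fusedBound_le hP₁ hP₂ hB hKB
  have hfb := ESCI.fusedBound_posDef hP₁ hP₂ hB hω'
  have hBpos : B.PosDef := by
    have := hfb.add_posSemidef hle
    rwa [add_sub_cancel] at this
  exact (hmin hω').trans (hJ _ _ hfb hBpos hle)
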